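/- Let $n>2$ and $d$ be natural numbers, $1<p<\infty$ and $\varepsilon>0$. For weights $W_Q^k,W_K^k,W_V^k,W_O^k\in\mathbb{R}^{d\times m}$ $(1\le k\le H)$, $W_1\in\mathbb{R}^{d\times r}$, $W_2\in\mathbb{R}^{r\times d}$, $b_1\in\mathbb{R}^{r}$, $b_2\in\mathbb{R}^{d}$, the *Transformer block without diag-attention* with $H$ heads of size $m$ and feed-forward width $r$ maps $X\in\mathbb{R}^{n\times d}$ (rows are tokens) to $$Y+\mathrm{ReLU}(YW_1+b_1)W_2+b_2,\qquad Y_i=X_i+\sum_{k=1}^{H}\sum_{j\ne i}A^k_{i,j}(X)\,(XW_V^k)_j\,W_O^{k\top},$$ where the biases are added to every row and $A^k(X)=\sigma\big(XW_Q^k(XW_K^k)^\top\big)$, with $\sigma$ the row-wise softmax. Let $\mathcal{T}^{H,m,r}$ be the class of Transformer networks without diag-attention, that is, of all maps $X\mapsto t(X+E)$, where $E\in\mathbb{R}^{n\times d}$ is a (trainable) positional embedding and $t$ is a composition of finitely many such blocks. For $f_1,f_2$ on $[0,1]^{n\times d}$ put $$d_p(f_1,f_2)=\Big(\int_{[0,1]^{n\times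 d}}\|f_1(X)-f_2(X)\|_p^p\,dX\Big)^{1/p},$$ where $\|\cdot\|_p$ is the entrywise $\ell_p$-norm. Then for every continuous $f:[0,1]^{n\times d}\to\mathbb{R}^{n\times d}$ there is a $g\in\mathcal{T}^{2,1,4}$ with $d_p(f,g)<\varepsilon$. -/

import Mathlib

open scoped Matrix

noncomputable section

namespace Sparse

/-- The softmax of a vector of scores. -/
def softmax {n : ℕ} (s : Fin n → ℝ) (j : Fin n) : ℝ :=
  Real.exp (s j) / ∑ l, Real.exp (s l)

/-- The weights of one attention head of size `m` on tokens of dimension `d`: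
query, key, value and output matrices. -/
structure Head (d m : ℕ) where
  WQ : Matrix (Fin d) (Fin m) ℝ
  WK : Matrix (Fin d) (Fin m) ℝ
  WV : Matrix (Fin d) (Fin m) ℝ
  WO : Matrix (Fin d) (Fin m) ℝ

/-- The self-attention matrix `A(X) = σ(X W_Q (X W_K)ᵀ)`, with `σ` the row-wise softmax. -/
def Head.attnMatrix {n d m : ℕ} (h : Head d m) (X : Matrix (Fin n) (Fin d) ℝ) :
    Matrix (Fin n) (Fin n) ℝ :=
  Matrix.of fun i j => softmax (((X * h.WQ) * (X * h.WK)ᵀ) i) j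

/-- The self-attention matrix with its diagonal entries removed. -/
def Head.offDiagAttnMatrix {n d m : ℕ} (h : Head d m) (X : Matrix (Fin n) (Fin d) ℝ) :
    Matrix (Fin n) (Fin n) ℝ :=
  Matrix.of fun i j => if j = i then 0 else h.attnMatrix X i j

/-- The weights of a Transformer block with `H` heads of size `m` and a feed-forward layer of
width `r`. -/
structure Block (d H m r : ℕ) where
  head : Fin H → Head d m
  W₁ : Matrix (Fin d) (Fin r) ℝ
  b₁ : Fin r → ℝ
  W₂ : Matrix (Fin r) (Fin d) ℝ
  b₂ : Fin d → ℝ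

/-- The self-attention layer without diag-attention, with skip connection: row `i` of the output is
`X_i + ∑_k ∑_{j ≠ i} A^k_{ij}(X) V^k_j(X) (W_O^k)ᵀ`, where `V^k(X) = X W_V^k`. -/
def Block.attn {n d H m r : ℕ} (B : Block d H m r) (X : Matrix (Fin n) (Fin d) ℝ) :
    Matrix (Fin n) (Fin d) ℝ :=
  X + ∑ k, (B.head k).offDiagAttnMatrix X * (X * (B.head k).WV) * (B.head k).WOᵀ

/-- The feed-forward layer, with skip connection: `Y + ReLU(Y W₁ + b₁) W₂ + b₂`; the biases are
added to every row, so that the layer acts on each token separately. -/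
def Block.feedForward {n d H m r : ℕ} (B : Block d H m r) (Y : Matrix (Fin n) (Fin d) ℝ) :
    Matrix (Fin n) (Fin d) ℝ :=
  Y + (Matrix.of fun i l => max ((Y * B.W₁) i l + B.b₁ l) 0) * B.W₂ + Matrix.of fun _ => B.b₂

/-- The map computed by a Transformer block without diag-attention. -/
def Block.apply {n d H m r : ℕ} (B : Block d H m r) (X : Matrix (Fin n) (Fin d) ℝ) :
    Matrix (Fin n) (Fin d) ℝ :=
  B.feedForward (B.attn X)

/-- The map computed by a stack of Transformer blocks, the first block of the list being applied
first. -/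
def stack {n d H m r : ℕ} (L : List (Block d H m r)) (X : Matrix (Fin n) (Fin d) ℝ) :
    Matrix (Fin n) (Fin d) ℝ :=
  L.foldl (fun Y B => B.apply Y) X

/-- The class `𝒯^{H,m,r}` of Transformer networks without diag-attention, on sequences of `n` tokens
of dimension `d`: a (trainable) positional embedding `E` is added to the input, which then runs
through finitely many blocks with `H` heads of size `m` and feed-forward width `r`. -/
def Transformers (n d H m r : ℕ) :
    Set (Matrix (Fin n) (Fin d) ℝ → Matrix (Fin n) (Fin d) ℝ) :=
  {g | ∃ (E : Matrix (Fin n) (Fin d) ℝ) (L : List (Block d H m r)), g = fun X => stack L (X + E)}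

/-- The cube `[0,1]^{n × d}`. -/
def cube (n d : ℕ) : Set (Matrix (Fin n) (Fin d) ℝ) :=
  {X | ∀ i j, X i j ∈ Set.Icc (0 : ℝ) 1}

/-- The distance `d_p(f₁, f₂) = (∫ ‖f₁(X) - f₂(X)‖_p^p dX)^{1/p}` over `[0,1]^{n × d}` with respect
to Lebesgue measure, where `‖·‖_p` is the entrywise `p`-norm. It takes values in `[0,∞]`. -/
def lpDist {n d : ℕ} (p : ℝ) (f₁ f₂ : Matrix (Fin n) (Fin d) ℝ → Matrix (Fin n) (Fin d) ℝ) :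
    ENNReal :=
  (∫⁻ X : Fin n → Fin d → ℝ in {X | Matrix.of X ∈ cube n d},
    ENNReal.ofReal (∑ i, ∑ j,
      |f₁ (Matrix.of X) i j - f₂ (Matrix.of X) i j| ^ p)) ^ (1 / p)

end Sparse

end

noncomputable section

namespace Sparse

/-! Attention is needed in only one block, with uniform weights; the rest is feed-forward. The
positional embedding puts row `i` into `[2i, 2i + 1]`. One-variable piecewise linear maps then round
every entry down to a grid, except on short intervals (`exists_quantizer`). What remains is finitely
many sequences, whose tokens reveal their positions.

Such sequences can be sent anywhere (`exists_stack_eq`). Tokens are first replaced by real codes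
independent over `ℚ`. The attention block then forms the own code plus twice the sum of the others,
and by `injective_codeSum` this number determines both sequence and position. A last tokenwise
interpolation (`exists_isTokenwise_eqOn`) reads off the required output.

Off the short intervals, uniform continuity of `f` bounds the error. On them, a final clipping to a
bound of `|f|` keeps the error bounded, and their measure is as small as desired. -/

/-! ### Tokenwise maps from feed-forward layers -/

/-- A map of tokens that some stack of blocks applies to each row separately. -/
def IsTokenwise (n : ℕ) {d : ℕ} (T : (Fin d → ℝ) → Fin d → ℝ) : Prop :=
  ∃ L : List (Block d 2 1 4), ∀ X : Matrix (Fin n) (Fin d) ℝ,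
    stack L X = Matrix.of fun i => T (X i)

/-- The head whose weights all vanish. -/
def zeroHead (d m : ℕ) : Head d m := ⟨0, 0, 0, 0⟩

theorem stack_append {n d H m r : ℕ} (L L' : List (Block d H m r))
    (X : Matrix (Fin n) (Fin d) ℝ) : stack (L ++ L') X = stack L' (stack L X) :=
  List.foldl_append

theorem IsTokenwise.id (n d : ℕ) : IsTokenwise n (fun x : Fin d → ℝ => x) :=
  ⟨[], fun _ => rfl⟩

theorem IsTokenwise.comp {n d : ℕ} {S T : (Fin d → ℝ) → Fin d → ℝ}
    (hS : IsTokenwise n S) (hT : IsTokenwise n T) : IsTokenwise n (fun x => S (T x)) := by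
  obtain ⟨L, hL⟩ := hS
  obtain ⟨L', hL'⟩ := hT
  refine ⟨L' ++ L, fun X => ?_⟩
  rw [stack_append, hL', hL]
  rfl

/-- One block realizes a ridge function with four pieces. -/
theorem isTokenwise_ridge (n : ℕ) {d : ℕ} (u w : Fin d → ℝ) (s b α : Fin 4 → ℝ) :
    IsTokenwise n (fun x => x + (∑ l, max (u ⬝ᵥ x * s l + b l) 0 * α l) • w) := by
  refine ⟨[⟨fun _ => zeroHead d 1, Matrix.of fun i l => u i * s l, b,
    Matrix.of fun l j => α l * w j, 0⟩], fun X => ?_⟩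
  ext i j
  have h : ∀ l, (X * Matrix.of fun i l => u i * s l) i l = u ⬝ᵥ X i * s l := by
    intro l
    simp only [Matrix.mul_apply, Matrix.of_apply, dotProduct, Finset.sum_mul]
    exact Finset.sum_congr rfl fun _ _ => by ring
  simp only [stack, List.foldl_cons, List.foldl_nil, Block.apply, Block.attn, zeroHead,
    Block.feedForward, Matrix.transpose_zero, Matrix.mul_zero, Finset.sum_const_zero, add_zero]
  rw [Matrix.add_apply, Matrix.add_apply, Matrix.mul_apply]
  simp only [Matrix.of_apply, Pi.zero_apply, add_zero, Pi.add_apply,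
    Pi.smul_apply, smul_eq_mul, Finset.sum_mul, mul_assoc]
  refine congrArg _ (Finset.sum_congr rfl fun l _ => ?_)
  rw [h l]

/-- A piecewise linear function of one variable with four pieces can be applied to every entry. -/
theorem isTokenwise_entrywise (n d : ℕ) (s b α : Fin 4 → ℝ) :
    IsTokenwise n
      (fun (x : Fin d → ℝ) j => x j + ∑ l, max (x j * s l + b l) 0 * α l) := by
  have key : ∀ t : Finset (Fin d), IsTokenwise n
      (fun (x : Fin d → ℝ) j =>
        if j ∈ t then x j + ∑ l, max (x j * s l + b l) 0 * α l else x j) := by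
    intro t
    induction t using Finset.induction_on with
    | empty => simpa using IsTokenwise.id n d
    | insert a t ha ih =>
      convert (isTokenwise_ridge n (Pi.single a 1) (Pi.single a 1) s b α).comp ih using 2 with x
      ext j
      by_cases hj : j = a
      · subst hj
        simp [ha]
      · simp [hj]
  simpa using key Finset.univ

/-- Clipping all entries to `[-M, M]`. -/
theorem isTokenwise_clip (n d : ℕ) {M : ℝ} (hM : 0 ≤ M) :
    IsTokenwise n (fun (x : Fin d → ℝ) j => max (-M) (min M (x j))) := by
  -- Clipping is `x + ReLU(-x - M) - ReLU(x - M)`.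
  convert isTokenwise_entrywise n d ![-1, 1, 0, 0] ![-M, -M, 0, 0] ![1, -1, 0, 0] using 3 with x j
  simp only [Fin.sum_univ_four, Matrix.cons_val]
  rcases le_total (x j) M with h1 | h1 <;> rcases le_total (-M) (x j) with h2 | h2
  · rw [min_eq_right h1, max_eq_right h2, max_eq_right (by linarith), max_eq_right (by linarith)]
    simp
  · rw [min_eq_right h1, max_eq_left h2, max_eq_left (by linarith), max_eq_right (by linarith)]
    simp
  · rw [min_eq_left h1, max_eq_right (by linarith), max_eq_right (by linarith),
      max_eq_left (by linarith)]
    simp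
  · rw [min_eq_left h1, max_eq_right (by linarith), max_eq_right (by linarith),
      max_eq_left (by linarith)]
    simp

/-! ### Rounding to a grid -/

/-- A continuous function of one variable that collapses all but a short piece of `[a, a + δ)`
to `a`, and is the identity elsewhere. -/
theorem exists_collapse (n d : ℕ) (a : ℝ) {δ η : ℝ} (hη : 0 < η) (hδ : η < δ) :
    ∃ ρ : ℝ → ℝ, IsTokenwise n (fun (x : Fin d → ℝ) j => ρ (x j)) ∧
      (∀ t, t ≤ a → ρ t = t) ∧ (∀ t, a ≤ t → t ≤ a + δ - η → ρ t = a) ∧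
      ∀ t, a + δ ≤ t → ρ t = t := by
  -- With breakpoints `a`, `a + δ - η`, `a + δ`, the slopes are `1`, `0`, `δ / η`, `1`.
  refine ⟨fun t => t + ∑ l, max (t * ![1, 1, 1, 0] l + ![-a, -(a + δ - η), -(a + δ), 0] l) 0 *
      ![-1, 1 + (δ - η) / η, -((δ - η) / η), 0] l, isTokenwise_entrywise n d _ _ _,
    fun t ht => ?_, fun t ht ht' => ?_, fun t ht => ?_⟩
  all_goals simp only [Fin.sum_univ_four, Matrix.cons_val]
  · rw [max_eq_right (by linarith), max_eq_right (by linarith), max_eq_right (by linarith)]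
    simp
  · rw [max_eq_left (by linarith), max_eq_right (by linarith), max_eq_right (by linarith)]
    ring
  · rw [max_eq_left (by linarith), max_eq_left (by linarith), max_eq_left (by linarith)]
    have := hη.ne'
    field_simp
    ring

/-- Rounding down to multiples of `δ` on `[0, K δ)`, outside short intervals. -/
theorem exists_quantizer (n d : ℕ) {δ η : ℝ} (hη : 0 < η) (hδ : η < δ) (K : ℕ) :
    ∃ ρ : ℝ → ℝ, IsTokenwise n (fun (x : Fin d → ℝ) j => ρ (x j)) ∧
      (∀ k < K, ∀ t, k * δ ≤ t → t ≤ k * δ + δ - η → ρ t = k * δ) ∧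
      ∀ t, K * δ ≤ t → ρ t = t := by
  induction K with
  | zero => exact ⟨fun t => t, IsTokenwise.id n d, by simp, by simp⟩
  | succ K ih =>
    obtain ⟨ρ, h, h1, h2⟩ := ih
    -- Cells are collapsed from left to right: the new map fixes everything up to `K * δ`, hence all
    -- values already rounded.
    obtain ⟨σ, g, g1, g2, g3⟩ := exists_collapse n d (K * δ) hη hδ
    refine ⟨fun t => σ (ρ t), g.comp h, fun k hk t ht ht' => ?_, fun t ht => ?_⟩ <;> beta_reduce
    · rcases Nat.lt_succ_iff_lt_or_eq.mp hk with hk | rfl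
      · rw [h1 k hk t ht ht', g1]
        have : (k : ℝ) ≤ K := by exact_mod_cast hk.le
        exact mul_le_mul_of_nonneg_right this (by linarith)
      · rw [h2 t ht, g2 t ht ht']
    · push_cast at ht
      rw [h2 t (by linarith), g3 t (by linarith)]

/-! ### Tokenwise interpolation -/

/-- A single point can be moved anywhere while finitely many others stay in place. -/
theorem exists_isTokenwise_move (n : ℕ) {d : ℕ} (u a c : Fin d → ℝ) (S : Finset (Fin d → ℝ))
    (hS : ∀ x ∈ S, u ⬝ᵥ x ≠ u ⬝ᵥ a) :
    ∃ T : (Fin d → ℝ) → Fin d → ℝ, IsTokenwise n T ∧ T a = c ∧ ∀ x ∈ S, T x = x := by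
  obtain ⟨r, hr, hrS⟩ : ∃ r : ℝ, 0 < r ∧ ∀ x ∈ S, r ≤ |u ⬝ᵥ x - u ⬝ᵥ a| := by
    clear c
    induction S using Finset.induction_on with
    | empty => exact ⟨1, one_pos, by simp⟩
    | insert y S hy ih =>
      obtain ⟨r, hr, h⟩ := ih fun x hx => hS x (Finset.mem_insert_of_mem hx)
      refine ⟨min r |u ⬝ᵥ y - u ⬝ᵥ a|, lt_min hr
        (abs_pos.mpr (sub_ne_zero.mpr (hS y (Finset.mem_insert_self _ _)))), fun x hx => ?_⟩
      rcases Finset.mem_insert.mp hx with rfl | hx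
      · exact min_le_right _ _
      · exact (min_le_left _ _).trans (h x hx)
  -- A hat function of `u ⬝ᵥ x`, of height `1` at `u ⬝ᵥ a` and zero at distance at least `r`,
  -- multiplies `c - a`.
  refine ⟨_, isTokenwise_ridge n u (c - a) ![1, 1, 1, 0]
    ![r - u ⬝ᵥ a, -(u ⬝ᵥ a), -r - u ⬝ᵥ a, 0] ![1 / r, -2 / r, 1 / r, 0], ?_, fun x hx => ?_⟩
  all_goals simp only [Fin.sum_univ_four, Matrix.cons_val]
  · rw [max_eq_left (by linarith), max_eq_left (by linarith), max_eq_right (by linarith)]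
    have : (u ⬝ᵥ a * 1 + (r - u ⬝ᵥ a)) * (1 / r) + (u ⬝ᵥ a * 1 + -(u ⬝ᵥ a)) * (-2 / r) +
        0 * (1 / r) + max (u ⬝ᵥ a * 0 + 0) 0 * 0 = 1 := by
      field_simp
      simp
    rw [this]
    simp
  · have h := hrS x hx
    rcases le_abs.mp h with h | h
    · rw [max_eq_left (by linarith), max_eq_left (by linarith), max_eq_left (by linarith)]
      have : (u ⬝ᵥ x * 1 + (r - u ⬝ᵥ a)) * (1 / r) + (u ⬝ᵥ x * 1 + -(u ⬝ᵥ a)) * (-2 / r) +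
        (u ⬝ᵥ x * 1 + (-r - u ⬝ᵥ a)) * (1 / r) + max (u ⬝ᵥ x * 0 + 0) 0 * 0 = 0 := by ring
      rw [this]
      simp
    · rw [max_eq_right (by linarith), max_eq_right (by linarith), max_eq_right (by linarith)]
      simp

/-- Points of `S`, separated by `u`, can be moved one after the other to places off `u ⁻¹' u S`,
while the points of `R` stay in place. -/
theorem exists_isTokenwise_move_finset (n : ℕ) {d : ℕ} (u : Fin d → ℝ) (S : Finset (Fin d → ℝ)) :
    ∀ (R : Finset (Fin d → ℝ)) (F : (Fin d → ℝ) → Fin d → ℝ),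
      Set.InjOn (fun x => u ⬝ᵥ x) S → (∀ r ∈ R, ∀ x ∈ S, u ⬝ᵥ r ≠ u ⬝ᵥ x) →
      (∀ y ∈ S, ∀ x ∈ S, u ⬝ᵥ F y ≠ u ⬝ᵥ x) →
      ∃ T : (Fin d → ℝ) → Fin d → ℝ, IsTokenwise n T ∧ (∀ x ∈ S, T x = F x) ∧
        ∀ r ∈ R, T r = r := by
  induction S using Finset.induction_on with
  | empty => exact fun R F _ _ _ => ⟨_, IsTokenwise.id n d, by simp, by simp⟩
  | insert a S ha ih =>
    intro R F hinj hR hF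
    obtain ⟨T, hT, hTa, hT'⟩ := exists_isTokenwise_move n u a (F a) (S ∪ R) (by
      intro x hx
      rcases Finset.mem_union.mp hx with hx | hx
      · intro h
        have := hinj (by simp [hx]) (by simp) h
        exact ha (this ▸ hx)
      · exact hR x hx a (Finset.mem_insert_self _ _))
    -- `F a` joins the fixed points, so that later moves leave the placed point alone.
    obtain ⟨T', hT1, hT2, hT3⟩ := ih (insert (F a) R) F
      (hinj.mono (by simp)) (by
        intro r hr x hx
        rcases Finset.mem_insert.mp hr with rfl | hr
        · exact hF a (Finset.mem_insert_self _ _) x (Finset.mem_insert_of_mem hx)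
        · exact hR r hr x (Finset.mem_insert_of_mem hx))
      (fun y hy x hx => hF y (Finset.mem_insert_of_mem hy) x (Finset.mem_insert_of_mem hx))
    refine ⟨_, hT1.comp hT, fun x hx => ?_, fun r hr => ?_⟩
    · rcases Finset.mem_insert.mp hx with rfl | hx
      · rw [hTa, hT3 _ (Finset.mem_insert_self _ _)]
      · rw [hT' x (Finset.mem_union_left _ hx), hT2 x hx]
    · rw [hT' r (Finset.mem_union_right _ hr), hT3 r (Finset.mem_insert_of_mem hr)]

/-- Finitely many nonzero vectors have a functional that vanishes at none of them. -/
theorem exists_dotProduct_ne_zero {d : ℕ} (S : Finset (Fin d → ℝ)) (hS : ∀ x ∈ S, x ≠ 0) :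
    ∃ u : Fin d → ℝ, ∀ x ∈ S, u ⬝ᵥ x ≠ 0 := by
  obtain ⟨φ, hφ⟩ := Module.exists_dual_forall_apply_ne_zero (K := ℝ)
    (fun x : S => (x : Fin d → ℝ)) fun x => hS x x.2
  refine ⟨fun j => φ (Pi.single j 1), fun x hx => ?_⟩
  convert hφ ⟨x, hx⟩
  rw [LinearMap.pi_apply_eq_sum_univ φ x]
  refine Finset.sum_congr rfl fun j _ => ?_
  rw [smul_eq_mul, mul_comm]
  refine congrArg (x j * φ ·) (funext fun k => ?_)
  simp [Pi.single_apply, eq_comm]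

/-- Stacks of feed-forward layers interpolate any data at finitely many points. -/
theorem exists_isTokenwise_eqOn (n : ℕ) {d : ℕ} (S : Finset (Fin d → ℝ))
    (F : (Fin d → ℝ) → Fin d → ℝ) :
    ∃ T : (Fin d → ℝ) → Fin d → ℝ, IsTokenwise n T ∧ ∀ x ∈ S, T x = F x := by
  classical
  rcases Nat.eq_zero_or_pos d with rfl | hd
  · exact ⟨_, IsTokenwise.id n 0, fun _ _ => Subsingleton.elim _ _⟩
  -- Besides separating `S`, `u` must not vanish on a basis vector, which serves as direction of
  -- translation below.
  obtain ⟨u, hu⟩ := exists_dotProduct_ne_zero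
    (insert (Pi.single ⟨0, hd⟩ 1) (S.offDiag.image fun q => q.1 - q.2)) (by
      intro x hx
      rcases Finset.mem_insert.mp hx with rfl | hx
      · simp
      · obtain ⟨q, hq, rfl⟩ := Finset.mem_image.mp hx
        exact sub_ne_zero.mpr (Finset.mem_offDiag.mp hq).2.2)
  have hinj : Set.InjOn (fun x => u ⬝ᵥ x) S := by
    intro x hx y hy hxy
    by_contra hne
    refine hu (x - y) (Finset.mem_insert_of_mem (Finset.mem_image.mpr
      ⟨(x, y), Finset.mem_offDiag.mpr ⟨hx, hy, hne⟩, rfl⟩)) ?_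
    rw [dotProduct_sub]
    exact sub_eq_zero.mpr hxy
  have hv := hu _ (Finset.mem_insert_self _ _)
  set v : Fin d → ℝ := Pi.single ⟨0, hd⟩ 1
  -- The targets `F x` may share a level of `u` with points of `S`. So `S` is first parked at `S + M
  -- • v`, on levels that avoid those of `S` and of the targets; each coincidence rules out one `M`.
  obtain ⟨M, hM⟩ := Infinite.exists_notMem_finset
    (((S ×ˢ S).image fun q => (u ⬝ᵥ q.1 - u ⬝ᵥ q.2) / (u ⬝ᵥ v)) ∪
      ((S ×ˢ S).image fun q => (u ⬝ᵥ F q.1 - u ⬝ᵥ q.2) / (u ⬝ᵥ v)))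
  have hM1 : ∀ x ∈ S, ∀ y ∈ S, u ⬝ᵥ (y + M • v) ≠ u ⬝ᵥ x := by
    intro x hx y hy h
    refine hM (Finset.mem_union_left _ (Finset.mem_image.mpr
      ⟨(x, y), Finset.mk_mem_product hx hy, ?_⟩))
    rw [dotProduct_add, dotProduct_smul, smul_eq_mul] at h
    rw [div_eq_iff hv]
    linarith
  have hM2 : ∀ x ∈ S, ∀ y ∈ S, u ⬝ᵥ F x ≠ u ⬝ᵥ (y + M • v) := by
    intro x hx y hy h
    refine hM (Finset.mem_union_right _ (Finset.mem_image.mpr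
      ⟨(x, y), Finset.mk_mem_product hx hy, ?_⟩))
    rw [dotProduct_add, dotProduct_smul, smul_eq_mul] at h
    rw [div_eq_iff hv]
    linarith
  obtain ⟨T, hT, hTS, -⟩ := exists_isTokenwise_move_finset n u S ∅ (fun x => x + M • v) hinj
    (by simp) (fun y hy x hx => hM1 x hx y hy)
  obtain ⟨T', hT', hTS', -⟩ := exists_isTokenwise_move_finset n u (S.image fun x => x + M • v) ∅
    (fun x => F (x - M • v)) (by
      intro x hx y hy hxy
      simp only [Finset.coe_image, Set.mem_image, Finset.mem_coe] at hx hy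
      obtain ⟨x, hx, rfl⟩ := hx
      obtain ⟨y, hy, rfl⟩ := hy
      rw [hinj hx hy (by simpa [dotProduct_add] using hxy)]) (by simp) (by
      intro y hy x hx
      obtain ⟨x, hx, rfl⟩ := Finset.mem_image.mp hx
      obtain ⟨y', hy', rfl⟩ := Finset.mem_image.mp hy
      simpa using hM2 y' hy' _ ‹_›)
  refine ⟨_, hT'.comp hT, fun x hx => ?_⟩
  rw [hTS x hx, hTS' _ (Finset.mem_image_of_mem _ hx), add_sub_cancel_right]

/-! ### The attention block and independent codes -/

/-- One block without feed-forward part adds, with uniform weights, the first entries of all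
other tokens to each token. -/
def sumBlock (n : ℕ) {d : ℕ} (j₀ : Fin d) : Block d 2 1 4 where
  head := ![⟨0, 0, Matrix.of fun j _ => Pi.single (M := fun _ => ℝ) j₀ (2 * (n : ℝ)) j,
    Matrix.of fun j _ => Pi.single (M := fun _ => ℝ) j₀ 1 j⟩, zeroHead d 1]
  W₁ := 0
  b₁ := 0
  W₂ := 0
  b₂ := 0

/-- Zero queries and keys make every attention weight `1 / n`, and the factor `2 * n` in the value
matrix turns this into `2`. -/
theorem sumBlock_apply {n d : ℕ} (j₀ : Fin d) (X : Matrix (Fin n) (Fin d) ℝ) (i : Fin n) :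
    (sumBlock n j₀).apply X i =
      X i + Pi.single j₀ (2 * ∑ j ∈ Finset.univ.erase i, X j j₀) := by
  have hn : (n : ℝ) ≠ 0 := by exact_mod_cast i.pos.ne'
  ext k
  simp only [Block.apply, Block.feedForward, Block.attn, sumBlock, Fin.sum_univ_two, zeroHead,
    Matrix.cons_val, Matrix.transpose_zero, Matrix.mul_zero, add_zero]
  simp only [Matrix.add_apply, Matrix.of_apply, Pi.zero_apply, add_zero, Pi.add_apply]
  congr 1
  simp only [Matrix.mul_apply, Finset.univ_unique, Matrix.transpose_apply,
    Matrix.of_apply, Head.offDiagAttnMatrix, Head.attnMatrix, softmax, Matrix.zero_apply,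
    mul_zero, Finset.sum_const_zero, Real.exp_zero, Finset.sum_const, Finset.card_univ,
    Fintype.card_fin, nsmul_eq_mul, mul_one, Pi.single_apply, mul_ite, Finset.sum_ite_eq',
    Finset.mem_univ, if_true]
  split_ifs
  · rw [← Finset.sum_erase Finset.univ (a := i) (by simp), Finset.card_singleton, Nat.cast_one,
      one_mul, Finset.mul_sum]
    refine Finset.sum_congr rfl fun j hj => ?_
    rw [if_neg (Finset.ne_of_mem_erase hj)]
    field_simp
  · rfl

/-- Supplies the codes of the tokens; `ℝ` has dimension continuum over `ℚ`. -/
theorem exists_linearIndependent_rat_real (ι : Type*) [Finite ι] :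
    ∃ c : ι → ℝ, LinearIndependent ℚ c := by
  obtain ⟨m, ⟨e⟩⟩ := Finite.exists_equiv_fin ι
  obtain ⟨v, hv⟩ := exists_linearIndependent_of_le_rank (R := ℚ) (M := ℝ) (n := m) (by
    rw [Real.rank_rat_real]
    exact (Cardinal.nat_lt_continuum m).le)
  exact ⟨_, hv.comp e e.injective⟩

/-- If tokens at different positions never agree, then the sums of independent codes, in which
the own code of a token counts once and those of the other tokens twice, determine the sequence
and the position. -/
theorem injective_codeSum {ι τ : Type*} [DecidableEq τ] {n : ℕ} (Z : ι → Fin n → τ)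
    (hpos : ∀ p q i j, Z p i = Z q j → i = j) (hZ : Function.Injective Z) (S : Finset τ)
    (hS : ∀ p i, Z p i ∈ S) (c : τ → ℝ) (hc : LinearIndependent ℚ fun s : S => c s) :
    Function.Injective fun q : ι × Fin n =>
      c (Z q.1 q.2) + 2 * ∑ j ∈ Finset.univ.erase q.2, c (Z q.1 j) := by
  -- The coefficient of `c s` in the sum for `(p, i)`. By `hpos` no token repeats within a sequence,
  -- so it is `0`, `1` or `2`.
  let m : ι → Fin n → τ → ℚ := fun p i s =>
    ∑ j, if Z p j = s then (if j = i then 1 else 2) else 0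
  have hm : ∀ p q i j, m q i (Z p j) =
      if Z q j = Z p j then (if j = i then 1 else 2) else 0 := by
    intro p q i j
    refine Finset.sum_eq_single j (fun k _ hk => if_neg fun h => hk (hpos _ _ _ _ h)) (by simp)
  have hsum : ∀ p i, c (Z p i) + 2 * ∑ j ∈ Finset.univ.erase i, c (Z p j) =
      ∑ s : S, m p i s • c s := by
    intro p i
    have : ∑ s : S, m p i s • c s = ∑ s ∈ S, m p i s • c s :=
      Finset.sum_coe_sort S fun s => m p i s • c s
    rw [this]
    simp only [m, Finset.sum_smul, ite_smul, zero_smul]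
    rw [Finset.sum_comm]
    simp only [Finset.sum_ite_eq, hS, if_true]
    rw [← Finset.add_sum_erase _ _ (Finset.mem_univ i), if_pos rfl, one_smul, Finset.mul_sum]
    refine congrArg _ (Finset.sum_congr rfl fun j hj => ?_)
    rw [if_neg (Finset.ne_of_mem_erase hj), Rat.smul_def]
    norm_num
  rintro ⟨p, i⟩ ⟨q, k⟩ h
  simp only [hsum] at h
  have h' : ∀ s : S, m p i s = m q k s := by
    intro s
    refine sub_eq_zero.mp (Fintype.linearIndependent_iff.mp hc (fun s => m p i s - m q k s) ?_ s)
    simp only [sub_smul, Finset.sum_sub_distrib, h, sub_self]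
  have key : ∀ j, (if j = i then (1 : ℚ) else 2) =
      if Z q j = Z p j then (if j = k then 1 else 2) else 0 := by
    intro j
    rw [← hm p q k j, ← h' ⟨_, hS p j⟩, hm p p i j, if_pos rfl]
  -- Nonzero coefficients show which tokens occur, hence the sequence; the only coefficient `1` then
  -- marks the position.
  have hpq : q = p := hZ (funext fun j => by
    by_contra hne
    have := key j
    rw [if_neg hne] at this
    split_ifs at this <;> norm_num at this)
  subst hpq
  have hik : i = k := by
    by_contra hne
    have := key i
    simp [hne] at this
  rw [hik]

/-- Stacks of blocks interpolate any data on finitely many sequences whose tokens determine their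
position. -/
theorem exists_stack_eq {ι : Type*} [Finite ι] {n d : ℕ} (Z F : ι → Matrix (Fin n) (Fin d) ℝ)
    (hpos : ∀ p q i j, Z p i = Z q j → i = j) (hZ : Function.Injective Z) :
    ∃ L : List (Block d 2 1 4), ∀ p, stack L (Z p) = F p := by
  classical
  have := Fintype.ofFinite ι
  rcases Nat.eq_zero_or_pos d with rfl | hd
  · exact ⟨[], fun p => Subsingleton.elim _ _⟩
  let j₀ : Fin d := ⟨0, hd⟩
  let S : Finset (Fin d → ℝ) := Finset.univ.image fun q : ι × Fin n => Z q.1 q.2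
  have hS : ∀ p i, Z p i ∈ S := fun p i =>
    Finset.mem_image.mpr ⟨(p, i), Finset.mem_univ _, rfl⟩
  obtain ⟨c₀, hc₀⟩ := exists_linearIndependent_rat_real S
  obtain ⟨c, hc⟩ : ∃ c : (Fin d → ℝ) → ℝ, ∀ s : S, c s = c₀ s :=
    ⟨fun s => if h : s ∈ S then c₀ ⟨s, h⟩ else 0, fun s => by simp⟩
  have hinj := injective_codeSum (fun p i => Z p i) hpos hZ S hS c (by simpa only [hc] using hc₀)
  set y : ι × Fin n → ℝ := fun q =>
    c (Z q.1 q.2) + 2 * ∑ j ∈ Finset.univ.erase q.2, c (Z q.1 j)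
  obtain ⟨T, ⟨L, hL⟩, hT⟩ := exists_isTokenwise_eqOn n S fun x => Pi.single j₀ (c x)
  let Y : ι × Fin n → Fin d → ℝ := fun q => Pi.single j₀ (y q)
  have hY : Function.Injective Y := fun q q' h => hinj (Pi.single_injective j₀ h)
  -- Since `Y` is injective, the desired output row is a function of the token `Y q` alone.
  obtain ⟨T', ⟨L', hL'⟩, hT'⟩ := exists_isTokenwise_eqOn n (Finset.univ.image Y)
    (Function.extend Y (fun q => F q.1 q.2) 0)
  refine ⟨L ++ sumBlock n j₀ :: L', fun p => ?_⟩
  have hB : ∀ i, (sumBlock n j₀).apply (stack L (Z p)) i = Y (p, i) := by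
    intro i
    rw [sumBlock_apply, hL]
    change T (Z p i) + Pi.single j₀ (2 * ∑ j ∈ Finset.univ.erase i, T (Z p j) j₀) = _
    simp only [hT _ (hS p _), Y, y, Pi.single_eq_same, ← Pi.single_add]
  rw [stack_append]
  change stack L' ((sumBlock n j₀).apply (stack L (Z p))) = _
  rw [hL']
  refine funext fun i => ?_
  change T' ((sumBlock n j₀).apply (stack L (Z p)) i) = _
  rw [hB, hT' _ (Finset.mem_image_of_mem _ (Finset.mem_univ _)), hY.extend_apply]

/-! ### Rounding the input and interpolating on the grid -/

/-- Off the short intervals of length `η` in front of the multiples of `1 / N`, a stack of blocks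
can round the input to the grid and return arbitrary values there. -/
theorem exists_stack_eq_rounded (n d N : ℕ) (hN : 0 < N) {η : ℝ} (hη : 0 < η)
    (hηN : η < 1 / (N : ℝ)) (F : Matrix (Fin n) (Fin d) ℝ → Matrix (Fin n) (Fin d) ℝ) :
    ∃ (E : Matrix (Fin n) (Fin d) ℝ) (L : List (Block d 2 1 4)), ∀ X ∈ cube n d,
      (∀ i j, ∀ k < 2 * n * N, X i j + 2 * (i : ℕ) ∉
        Set.Ioo (k * (1 / (N : ℝ)) + 1 / N - η) (k * (1 / (N : ℝ)) + 1 / N)) →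
      ∃ Q ∈ cube n d, (∀ i j, |X i j - Q i j| ≤ 1 / N) ∧ stack L (X + E) = F Q := by
  rcases Nat.eq_zero_or_pos d with rfl | hd
  · exact ⟨0, [], fun X hX _ => ⟨X, hX, fun i j => j.elim0, Subsingleton.elim _ _⟩⟩
  have hN' : (0 : ℝ) < N := by exact_mod_cast hN
  -- There are `N + 1` grid values per entry, because the entry `1` is rounded to itself.
  let G : (Fin n → Fin d → Fin (N + 1)) → Matrix (Fin n) (Fin d) ℝ :=
    fun q => Matrix.of fun i j => ((q i j : ℕ) : ℝ) / N
  -- Shifts by `i` instead of `2 * i` would let the value `1` of a row meet the value `0` of the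
  -- next.
  let E : Matrix (Fin n) (Fin d) ℝ := Matrix.of fun i _ => 2 * ((i : ℕ) : ℝ)
  have hG0 : ∀ q, G q ∈ cube n d := by
    intro q i j
    have : ((q i j : ℕ) : ℝ) ≤ N := by exact_mod_cast Nat.le_of_lt_succ (q i j).2
    exact ⟨by simp only [G, Matrix.of_apply]; positivity, (div_le_one hN').mpr this⟩
  obtain ⟨ρ, ⟨L, hL⟩, hρ, -⟩ := exists_quantizer n d hη hηN (2 * n * N)
  obtain ⟨L', hL'⟩ := exists_stack_eq (fun q => G q + E) (fun q => F (G q)) (by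
    intro p q i j h
    have h1 := congrFun h ⟨0, hd⟩
    have hp := hG0 p i ⟨0, hd⟩
    have hq := hG0 q j ⟨0, hd⟩
    simp only [Matrix.add_apply, E, Matrix.of_apply, Set.mem_Icc] at h1 hp hq
    have h2 : ((i : ℕ) : ℝ) < (j : ℕ) + 1 := by linarith [hp.1, hq.2]
    have h3 : ((j : ℕ) : ℝ) < (i : ℕ) + 1 := by linarith [hq.1, hp.2]
    norm_cast at h2 h3
    exact Fin.ext (by omega)) (by
    intro p q h
    funext i j
    have h0 : G p i j + E i j = G q i j + E i j := congrFun (congrFun h i) j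
    have h1 := add_right_cancel h0
    simp only [G, Matrix.of_apply] at h1
    rw [div_left_inj' hN'.ne'] at h1
    exact Fin.ext (by exact_mod_cast h1))
  refine ⟨E, L ++ L', fun X hX hgood => ?_⟩
  have hfl : ∀ i j, ⌊X i j * N⌋₊ < N + 1 := by
    intro i j
    refine Nat.lt_succ_of_le (Nat.floor_le_of_le ?_)
    exact mul_le_of_le_one_left hN'.le (hX i j).2
  let q : Fin n → Fin d → Fin (N + 1) := fun i j => ⟨⌊X i j * N⌋₊, hfl i j⟩
  have hle : ∀ i j, G q i j ≤ X i j := fun i j =>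
    (div_le_iff₀ hN').mpr (Nat.floor_le (mul_nonneg (hX i j).1 hN'.le))
  have hlt : ∀ i j, X i j < G q i j + 1 / N := by
    intro i j
    have : G q i j + 1 / N = (⌊X i j * N⌋₊ + 1 : ℝ) / N := by
      simp only [G, q, Matrix.of_apply]
      ring
    rw [this]
    exact (lt_div_iff₀ hN').mpr (Nat.lt_floor_add_one _)
  refine ⟨G q, hG0 q, fun i j => ?_, ?_⟩
  · rw [abs_of_nonneg (sub_nonneg.mpr (hle i j))]
    linarith [hlt i j]
  · have : stack L (X + E) = G q + E := by
      rw [hL]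
      ext i j
      have hk : ⌊X i j * N⌋₊ + 2 * i * N < 2 * n * N := by
        have h1 := hfl i j
        have h2 : (2 * (i : ℕ) + 2) * N ≤ 2 * n * N := Nat.mul_le_mul_right _ (by omega)
        nlinarith
      have hcast : ((⌊X i j * N⌋₊ + 2 * i * N : ℕ) : ℝ) * (1 / (N : ℝ)) = (G q + E) i j := by
        simp only [G, q, E, Matrix.add_apply, Matrix.of_apply]
        push_cast
        field_simp
      have hval : (X + E) i j = X i j + 2 * (i : ℕ) := rfl
      have hval' : (G q + E) i j = G q i j + 2 * (i : ℕ) := rfl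
      have h1 := hgood i j _ hk
      rw [hcast, hval'] at h1
      have h2 : (X + E) i j ≤ G q i j + 2 * (i : ℕ) + 1 / N - η := by
        by_contra hcon
        rw [hval] at hcon
        exact h1 ⟨not_le.mp hcon, by linarith [hlt i j]⟩
      rw [Matrix.of_apply, ← hcast]
      refine hρ _ hk _ ?_ ?_
      · rw [hcast, hval, hval']
        linarith [hle i j]
      · rw [hcast, hval']
        exact h2
    rw [stack_append, this, hL']

/-! ### Measure estimates and the conclusion -/

theorem setOf_mem_cube (n d : ℕ) : {X : Fin n → Fin d → ℝ | Matrix.of X ∈ cube n d} =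
    Set.univ.pi fun _ => Set.univ.pi fun _ => Set.Icc (0 : ℝ) 1 := by
  ext X
  simp only [cube, Set.mem_ofPred_eq, Set.mem_pi, Set.mem_univ, forall_true_left, Matrix.of_apply]

open MeasureTheory in
/-- The part of the cube where some entry lies in a set is no larger than that set. -/
theorem volume_restrict_cube_le {n d : ℕ} (i : Fin n) (j : Fin d) {B : Set ℝ}
    (hB : MeasurableSet B) :
    (volume : Measure (Fin n → Fin d → ℝ)).restrict {X | Matrix.of X ∈ cube n d}
      {X | X i j ∈ B} ≤ volume B := by
  -- Lebesgue measure on the cube is a product of probability measures, so evaluation at an entry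
  -- preserves measure.
  have : IsProbabilityMeasure ((volume : Measure ℝ).restrict (Set.Icc 0 1)) := ⟨by simp⟩
  rw [setOf_mem_cube, volume_pi, Measure.restrict_pi_pi]
  simp only [volume_pi, Measure.restrict_pi_pi]
  have h1 := measurePreserving_eval (fun _ : Fin n => Measure.pi fun _ : Fin d =>
    (volume : Measure ℝ).restrict (Set.Icc 0 1)) i
  have h2 := measurePreserving_eval (fun _ : Fin d =>
    (volume : Measure ℝ).restrict (Set.Icc 0 1)) j
  have h3 := (h2.comp h1).measure_preimage hB.nullMeasurableSet
  exact h3.le.trans (Measure.restrict_apply_le _ _)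

end Sparse

end

open MeasureTheory in
theorem theorem1 (n d : ℕ) (hn : 2 < n) (p : ℝ) (hp : 1 < p) (ε : ℝ) (hε : 0 < ε)
    (f : Matrix (Fin n) (Fin d) ℝ → Matrix (Fin n) (Fin d) ℝ)
    (hf : ContinuousOn f (Sparse.cube n d)) :
    ∃ g ∈ Sparse.Transformers n d 2 1 4, Sparse.lpDist p f g < ENNReal.ofReal ε := by
  set s : Set (Fin n → Fin d → ℝ) := {X | Matrix.of X ∈ Sparse.cube n d} with hs
  have hsK : IsCompact s := by
    rw [hs, Sparse.setOf_mem_cube]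
    exact isCompact_univ_pi fun _ => isCompact_univ_pi fun _ => isCompact_Icc
  have hsm : MeasurableSet s := hsK.isClosed.measurableSet
  let f' : (Fin n → Fin d → ℝ) → Fin n → Fin d → ℝ := f
  have hf' : ContinuousOn f' s := hf
  obtain ⟨M, hM0, hM⟩ : ∃ M : ℝ, 0 ≤ M ∧ ∀ X ∈ s, ∀ i j, |f' X i j| ≤ M := by
    obtain ⟨C, hC⟩ := hsK.exists_bound_of_continuousOn hf'
    exact ⟨max C 0, le_max_right _ _, fun X hX i j => (norm_le_pi_norm (f' X i) j).trans
      ((norm_le_pi_norm (f' X) i).trans ((hC X hX).trans (le_max_left _ _)))⟩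
  set D : ℝ := n * d with hD
  have hD0 : 0 ≤ D := by positivity
  -- An entrywise error of `a * ε` costs at most `ε ^ p / 2` in total, as `a ^ p ≤ a` and `D * a ≤ 1
  -- / 2`; the `+ 1` covers `D = 0`.
  set a : ℝ := 1 / (2 * (D + 1)) with ha
  have ha0 : 0 < a := by positivity
  have hpow : D * (a * ε) ^ p ≤ ε ^ p / 2 := by
    rw [Real.mul_rpow ha0.le hε.le]
    have h1 : a ^ p ≤ a := by
      have h2 : a ≤ 1 := by
        rw [ha, div_le_one (by positivity)]
        linarith
      simpa using Real.rpow_le_rpow_of_exponent_ge ha0 h2 hp.le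
    have h3 : D * a ≤ 1 / 2 := by
      rw [ha]
      field_simp
      linarith
    have h4 : 0 < ε ^ p := by positivity
    calc D * (a ^ p * ε ^ p) ≤ D * (a * ε ^ p) := by gcongr
      _ = D * a * ε ^ p := by ring
      _ ≤ 1 / 2 * ε ^ p := by gcongr
      _ = ε ^ p / 2 := by ring
  obtain ⟨δ, hδ, hunif⟩ := Metric.uniformContinuousOn_iff.mp
    (hsK.uniformContinuousOn_of_continuous hf') (a * ε) (by positivity)
  obtain ⟨N, hN⟩ := exists_nat_one_div_lt hδ
  set C : ℝ := D * (2 * M) ^ p with hC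
  have hC0 : 0 ≤ C := by positivity
  set K : ℕ := 2 * n * (N + 1) with hK
  -- `C` bounds the integrand on the exceptional set and `D * (K * η)` the measure of that set.
  obtain ⟨η, hη0, hηN, hη⟩ : ∃ η : ℝ, 0 < η ∧ η < 1 / ((N + 1 : ℕ) : ℝ) ∧
      C * (D * (K * η)) ≤ ε ^ p / 4 := by
    have hpos : 0 < ε ^ p / 4 / (C * D * K + 1) := by positivity
    refine ⟨min (1 / ((N + 1 : ℕ) : ℝ) / 2) (ε ^ p / 4 / (C * D * K + 1)),
      lt_min (by positivity) hpos,
      (min_le_left _ _).trans_lt (half_lt_self (by positivity)), ?_⟩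
    calc C * (D * (K * min (1 / ((N + 1 : ℕ) : ℝ) / 2) (ε ^ p / 4 / (C * D * K + 1))))
        ≤ C * (D * (K * (ε ^ p / 4 / (C * D * K + 1)))) := by
          gcongr
          exact min_le_right _ _
      _ ≤ (C * D * K + 1) * (ε ^ p / 4 / (C * D * K + 1)) := by
          linarith
      _ = ε ^ p / 4 := by field_simp
  obtain ⟨E, L, hL⟩ := Sparse.exists_stack_eq_rounded n d (N + 1) N.succ_pos hη0 hηN f
  obtain ⟨L', hL'⟩ := Sparse.isTokenwise_clip n d hM0
  let B : Fin n → Set ℝ := fun i => ⋃ k ∈ Finset.range K,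
    Set.Ioo (k * (1 / ((N + 1 : ℕ) : ℝ)) + 1 / ((N + 1 : ℕ) : ℝ) - η - 2 * (i : ℕ))
      (k * (1 / ((N + 1 : ℕ) : ℝ)) + 1 / ((N + 1 : ℕ) : ℝ) - 2 * (i : ℕ))
  have hBm : ∀ i, MeasurableSet (B i) := fun i =>
    Finset.measurableSet_biUnion _ fun _ _ => measurableSet_Ioo
  have hBv : ∀ i, volume (B i) ≤ ENNReal.ofReal (K * η) := by
    intro i
    refine (measure_biUnion_finset_le _ _).trans (le_of_eq ?_)
    simp only [Real.volume_Ioo, sub_sub_sub_cancel_right, sub_sub_cancel, Finset.sum_const,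
      Finset.card_range, nsmul_eq_mul]
    rw [ENNReal.ofReal_mul (by positivity), ENNReal.ofReal_natCast]
  let A : Set (Fin n → Fin d → ℝ) := ⋃ i, ⋃ j, {X | X i j ∈ B i}
  have hAm : MeasurableSet A := MeasurableSet.iUnion fun i => MeasurableSet.iUnion fun j =>
    (by fun_prop : Measurable fun X : Fin n → Fin d → ℝ => X i j) (hBm i)
  have hAv : volume.restrict s A ≤ ENNReal.ofReal (D * (K * η)) := by
    calc volume.restrict s A ≤ ∑ i : Fin n, ∑ j : Fin d, ENNReal.ofReal (K * η) := by
          refine (measure_iUnion_fintype_le _ _).trans (Finset.sum_le_sum fun i _ => ?_)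
          refine (measure_iUnion_fintype_le _ _).trans (Finset.sum_le_sum fun j _ => ?_)
          exact (Sparse.volume_restrict_cube_le i j (hBm i)).trans (hBv i)
      _ = ENNReal.ofReal (D * (K * η)) := by
          simp only [Finset.sum_const, Finset.card_univ, Fintype.card_fin, nsmul_eq_mul]
          rw [ENNReal.ofReal_mul hD0, hD, ENNReal.ofReal_mul (p := (n : ℝ)) (by positivity),
            ENNReal.ofReal_natCast, ENNReal.ofReal_natCast, mul_assoc]
  have hvs : volume s = 1 := by
    rw [hs, Sparse.setOf_mem_cube]
    simp only [volume_pi_pi]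
    simp
  have hg : ∀ X i j, Sparse.stack (L ++ L') (X + E) i j =
      max (-M) (min M (Sparse.stack L (X + E) i j)) := by
    intro X i j
    rw [Sparse.stack_append, hL', Matrix.of_apply]
  have hsum : ∀ (Y : Fin n → Fin d → ℝ) (c : ℝ), (∀ i j, |Y i j| ≤ c) →
      ∑ i, ∑ j, |Y i j| ^ p ≤ D * c ^ p := by
    intro Y c hY
    calc ∑ i, ∑ j, |Y i j| ^ p ≤ ∑ _i : Fin n, ∑ _j : Fin d, c ^ p :=
          Finset.sum_le_sum fun i _ => Finset.sum_le_sum fun j _ =>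
            Real.rpow_le_rpow (abs_nonneg _) (hY i j) (by linarith)
      _ = D * c ^ p := by simp [hD, mul_assoc]
  refine ⟨_, ⟨E, L ++ L', rfl⟩, ?_⟩
  have hp0 : 0 < p := by linarith
  rw [Sparse.lpDist, one_div, ENNReal.rpow_inv_lt_iff hp0, ENNReal.ofReal_rpow_of_pos hε]
  calc _ ≤ ∫⁻ X in s, (ENNReal.ofReal (ε ^ p / 2) + A.indicator (fun _ => ENNReal.ofReal C) X) := by
        refine setLIntegral_mono' hsm fun X hX => ?_
        by_cases hXA : X ∈ A
        · rw [Set.indicator_of_mem hXA]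
          refine le_add_left (ENNReal.ofReal_le_ofReal (hsum (fun i j => _) _ fun i j => ?_))
          have h1 := abs_le.mp (hM X hX i j)
          have h2 := le_max_left (-M) (min M (Sparse.stack L (Matrix.of X + E) i j))
          have h3 : max (-M) (min M (Sparse.stack L (Matrix.of X + E) i j)) ≤ M :=
            max_le (by linarith) (min_le_left _ _)
          rw [hg, abs_le]
          change -(2 * M) ≤ f' X i j - _ ∧ f' X i j - _ ≤ 2 * M
          exact ⟨by linarith, by linarith⟩
        · rw [Set.indicator_of_notMem hXA, add_zero]
          refine ENNReal.ofReal_le_ofReal ((hsum (fun i j => _) (a * ε) fun i j => ?_).trans hpow)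
          obtain ⟨Q, hQ, hXQ, hLQ⟩ := hL (Matrix.of X) hX (by
            intro i j k hk hmem
            refine hXA (Set.mem_iUnion.mpr ⟨i, Set.mem_iUnion.mpr ⟨j, ?_⟩⟩)
            refine Set.mem_biUnion (Finset.mem_range.mpr hk) ?_
            have h1 := hmem.1
            have h2 := hmem.2
            simp only [Matrix.of_apply] at h1 h2
            exact ⟨by linarith, by linarith⟩)
          rw [hg, hLQ]
          have hQb := abs_le.mp (hM Q hQ i j)
          change |f' X i j - max (-M) (min M (f' Q i j))| ≤ a * ε
          -- Clipping does not change values of `f` on the cube.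
          rw [min_eq_right hQb.2, max_eq_right hQb.1]
          have hdist : dist (X : Fin n → Fin d → ℝ) Q < δ := by
            refine lt_of_le_of_lt ((dist_pi_le_iff (by positivity)).mpr fun i =>
              (dist_pi_le_iff (by positivity)).mpr fun j => ?_) hN
            have := hXQ i j
            push_cast at this
            exact this
          have h5 := hunif X hX Q hQ hdist
          exact ((dist_le_pi_dist (f' X i) (f' Q i) j).trans
            (dist_le_pi_dist (f' X) (f' Q) i)).trans h5.le
    _ = ENNReal.ofReal (ε ^ p / 2) + ENNReal.ofReal C * volume.restrict s A := by
        rw [lintegral_add_left measurable_const, lintegral_indicator_const hAm]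
        simp [hvs]
    _ ≤ ENNReal.ofReal (ε ^ p / 2) + ENNReal.ofReal (ε ^ p / 4) := by
        gcongr
        refine (mul_le_mul_right hAv _).trans ?_
        rw [← ENNReal.ofReal_mul hC0]
        exact ENNReal.ofReal_le_ofReal hη
    _ < ENNReal.ofReal (ε ^ p) := by
        have h4 : 0 < ε ^ p := by positivity
        rw [← ENNReal.ofReal_add (by positivity) (by positivity)]
        exact (ENNReal.ofReal_lt_ofReal_iff h4).mpr (by linarith)
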